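/- Let $k\ge 1$ be an integer, let $\varepsilon$ be an integer prime to $k$, and let $s>0$ be a real number. Put $$F_{k,\varepsilon}(s)=\int_0^\infty\int_0^s\ \sum_{\substack{m,n\in\mathbb Z\\ m\equiv\varepsilon n\ (\mathrm{mod}\ k)}} mn\,e^{-t(m^2+n^2a^2)}\;da\,dt .$$ For $\tau$ in the upper half-plane let $$\mathcal L(\tau)=\frac{\pi i\tau}{12}-\sum_{n=1}^\infty\frac{\sigma(n)}{n}\,e^{2\pi i n\tau},$$ where $\sigma(n)$ is the sum of the positive divisors of $n$; this is the principal branch (real on the positive imaginary axis) of the logarithm of the Dedekind function $\eta(\tau)=e^{\pi i\tau/12}\prod_{n\ge1}(1-e^{2\pi i n\tau})$. Then the series converges absolutely for all $t,a>0$, the iterated integral converges (as iterated Lebesgue integrals: for every $t>0$ the inner integrand is integrable over $(0,s)$, and the resulting function of $t$ is integrable over $(0,\infty)$), and for every integer $\varepsilon^*$ with $\varepsilon\varepsilon^*\equiv1\pmod k$ $$F_{k,\varepsilon}(s)=2\operatorname{Im}\mathcal L\!\left(\frac{-\varepsilon^*+is^{-1}}{k}\right)+\frac{\pi\varepsilon^*}{6k}.$$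 -/

import Mathlib

open Complex MeasureTheory Set

/-- The logarithm `𝓛(τ) = π i τ / 12 - ∑_{n ≥ 1} (σ(n) / n) e^{2 π i n τ}` of the Dedekind
η-function, where `σ(n)` is the sum of the positive divisors of `n`; it is meant for `Im τ > 0`.
The lemmas below confirm that it is the principal branch: it is holomorphic on the upper
half-plane, a logarithm of `η` there, and real on the positive imaginary axis. -/
noncomputable def logEta (τ : ℂ) : ℂ :=
  Real.pi * I * τ / 12 -
    ∑' n : ℕ+, ((ArithmeticFunction.sigma 1 n : ℂ) / (n : ℂ)) * exp (2 * Real.pi * I * n * τ)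

/-- The theta-type series `∑_{m ≡ ε n (mod k)} m n e^{-t (m² + n² a²)}`, summed over all pairs of
integers `(m, n)` satisfying the congruence. -/
noncomputable def thetaSum (k : ℕ) (ε : ℤ) (t a : ℝ) : ℝ :=
  ∑' p : {p : ℤ × ℤ // p.1 ≡ ε * p.2 [ZMOD (k : ℤ)]},
    (p.1.1 : ℝ) * (p.1.2 : ℝ) * Real.exp (-t * ((p.1.1 : ℝ) ^ 2 + (p.1.2 : ℝ) ^ 2 * a ^ 2))

/-- `F_{k,ε}(s) = ∫_0^∞ ∫_0^s ∑_{m ≡ ε n (mod k)} m n e^{-t (m² + n² a²)} da dt`. -/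
noncomputable def etaFormIntegral (k : ℕ) (ε : ℤ) (s : ℝ) : ℝ :=
  ∫ t in Ioi (0 : ℝ), ∫ a in (0 : ℝ)..s, thetaSum k ε t a

theorem norm_exp_two_pi_mul_lt_one {τ : ℂ} (hτ : 0 < τ.im) :
    ‖exp (2 * Real.pi * I * τ)‖ < 1 := by
  have h := UpperHalfPlane.norm_exp_two_pi_I_lt_one ⟨τ, hτ⟩
  simpa using h

/-- `logEta` is a logarithm of the Dedekind η-function on the upper half-plane. -/
theorem exp_logEta {τ : ℂ} (hτ : 0 < τ.im) : exp (logEta τ) = ModularForm.eta τ := by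
  set q := exp (2 * Real.pi * I * τ) with hq
  have hq1 : ‖q‖ < 1 := norm_exp_two_pi_mul_lt_one hτ
  have hs0 : Summable fun c : ℕ+ × ℕ+ ↦ q ^ (c.1 * c.2 : ℕ) := by
    simpa using summable_prod_mul_pow 0 hq1
  have hs : Summable fun c : ℕ+ × ℕ+ ↦ q ^ (c.1 * c.2 : ℕ) / (c.2 : ℂ) := by
    refine Summable.of_norm_bounded hs0.norm fun c ↦ ?_
    rw [norm_div]
    refine div_le_self (norm_nonneg _) ?_
    rw [Complex.norm_natCast]
    exact_mod_cast c.2.pos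
  have hlog : ∀ a : ℕ+, ∑' b : ℕ+, q ^ (a * b : ℕ) / (b : ℂ) = -log (1 - q ^ (a : ℕ)) := by
    intro a
    have ha : ‖q ^ (a : ℕ)‖ < 1 := by
      rw [norm_pow]; exact pow_lt_one₀ (norm_nonneg _) hq1 a.ne_zero
    rw [← (hasSum_taylorSeries_neg_log' ha).tsum_eq,
      tsum_pnat_eq_tsum_succ (f := fun b : ℕ ↦ q ^ (a * b : ℕ) / (b : ℂ))]
    simp [pow_mul]
  have hsig : ∑' n : ℕ+, ((ArithmeticFunction.sigma 1 n : ℂ) / (n : ℂ)) *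
      exp (2 * Real.pi * I * n * τ) = ∑' c : ℕ+ × ℕ+, q ^ (c.1 * c.2 : ℕ) / (c.2 : ℂ) := by
    rw [← sigmaAntidiagonalEquivProd.tsum_eq]
    have hs' := sigmaAntidiagonalEquivProd.summable_iff.mpr hs
    rw [Summable.tsum_sigma (by simpa [Function.comp_def] using! hs')]
    refine tsum_congr fun n ↦ ?_
    have hexp : exp (2 * Real.pi * I * n * τ) = q ^ (n : ℕ) := by
      rw [hq, ← Complex.exp_nat_mul]; congr 1; ring
    rw [hexp, tsum_fintype]
    have h1 : ∀ x : (n : ℕ).divisorsAntidiagonal,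
        q ^ (((sigmaAntidiagonalEquivProd ⟨n, x⟩).1 : ℕ) *
          ((sigmaAntidiagonalEquivProd ⟨n, x⟩).2 : ℕ)) /
          ((sigmaAntidiagonalEquivProd ⟨n, x⟩).2 : ℂ) =
        (fun y : ℕ × ℕ ↦ (y.1 : ℂ) / n * q ^ (n : ℕ)) x.1 := by
      rintro ⟨⟨u, v⟩, hx⟩
      have hx' := (Nat.mem_divisorsAntidiagonal.mp hx).1
      have hn : (n : ℂ) ≠ 0 := by exact_mod_cast n.ne_zero
      have huv : (u : ℂ) * v = n := by exact_mod_cast hx'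
      have hv : (v : ℂ) ≠ 0 := by rintro h; simp [h] at huv; exact hn huv.symm
      simp only [sigmaAntidiagonalEquivProd, divisorsAntidiagonalFactors, Equiv.coe_fn_mk,
        PNat.mk_coe] at hx' ⊢
      rw [hx', div_mul_eq_mul_div, div_eq_div_iff hv hn, ← huv]
      ring
    rw [Finset.sum_congr rfl fun x _ ↦ h1 x, Finset.univ_eq_attach,
      Finset.sum_attach (n : ℕ).divisorsAntidiagonal (fun y : ℕ × ℕ ↦ (y.1 : ℂ) / n * q ^ (n : ℕ)),
      Nat.sum_divisorsAntidiagonal (fun x _ ↦ (x : ℂ) / n * q ^ (n : ℕ)),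
      ← Finset.sum_mul, ← Finset.sum_div, ArithmeticFunction.sigma_one_apply]
    push_cast
    rfl
  have hL : logEta τ = Real.pi * I * τ / 12 + ∑' a : ℕ, log (1 - q ^ (a + 1)) := by
    rw [logEta, hsig, hs.tsum_prod, tsum_congr hlog, tsum_neg, sub_neg_eq_add,
      tsum_pnat_eq_tsum_succ (f := fun a : ℕ ↦ log (1 - q ^ a))]
  have hne : ∀ a : ℕ, 1 - q ^ (a + 1) ≠ 0 := by
    intro a h
    have h2 : ‖q ^ (a + 1)‖ < 1 := by
      rw [norm_pow]; exact pow_lt_one₀ (norm_nonneg _) hq1 (Nat.succ_ne_zero a)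
    have h3 : ‖(1 : ℂ)‖ < 1 := by rwa [← sub_eq_zero.mp h] at h2
    rw [norm_one] at h3
    exact lt_irrefl _ h3
  have hsl : Summable fun a : ℕ ↦ log (1 - q ^ (a + 1)) := by
    have h0 : Summable fun a : ℕ ↦ -q ^ (a + 1) :=
      ((summable_geometric_of_norm_lt_one hq1).mul_left (-q)).congr fun a ↦ by ring
    refine (Complex.summable_log_one_add_of_summable h0).congr fun a ↦ ?_
    rw [← sub_eq_add_neg]
  rw [hL, Complex.exp_add, Complex.cexp_tsum_eq_tprod hne hsl, ModularForm.eta]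
  congr 1
  · rw [Function.Periodic.qParam]; congr 1; push_cast; ring
  · simp only [ModularForm.eta_q_eq_pow, hq]

/-- `logEta` is holomorphic on the upper half-plane. -/
theorem differentiableOn_logEta : DifferentiableOn ℂ logEta {τ : ℂ | 0 < τ.im} := by
  intro τ₀ hτ₀
  have hτ₀' : 0 < τ₀.im := hτ₀
  set δ : ℝ := τ₀.im / 2 with hδ
  have hδ0 : 0 < δ := by positivity
  have hU : IsOpen {τ : ℂ | δ < τ.im} := isOpen_lt continuous_const Complex.continuous_im
  have hmem : τ₀ ∈ {τ : ℂ | δ < τ.im} := by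
    show δ < τ₀.im
    linarith
  have hr : ‖Real.exp (-(2 * Real.pi * δ))‖ < 1 := by
    rw [Real.norm_eq_abs, abs_of_pos (Real.exp_pos _), Real.exp_lt_one_iff]
    have := Real.pi_pos
    have : 0 < 2 * Real.pi * δ := by positivity
    linarith
  have hsum : Summable fun n : ℕ+ ↦ ((n : ℕ) : ℝ) ^ 1 * Real.exp (-(2 * Real.pi * δ)) ^ (n : ℕ) :=
    (summable_pow_mul_geometric_of_norm_lt_one 1 hr).subtype _
  have hd : DifferentiableOn ℂ (fun τ : ℂ ↦ ∑' n : ℕ+,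
      ((ArithmeticFunction.sigma 1 n : ℂ) / (n : ℂ)) * exp (2 * Real.pi * I * n * τ))
      {τ : ℂ | δ < τ.im} := by
    refine differentiableOn_tsum_of_summable_norm hsum (fun n ↦ by fun_prop) hU ?_
    intro n τ hτ
    have hτ' : δ < τ.im := hτ
    have hn : (0 : ℝ) < (n : ℕ) := by exact_mod_cast n.pos
    rw [norm_mul, norm_div, Complex.norm_natCast, Complex.norm_natCast, Complex.norm_exp,
      ← Real.exp_nat_mul]
    gcongr
    · rw [div_le_iff₀ hn, pow_one]
      have hle : ArithmeticFunction.sigma 1 (n : ℕ) ≤ (n : ℕ) * (n : ℕ) :=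
        (ArithmeticFunction.sigma_le_pow_succ 1 (n : ℕ)).trans_eq (pow_two _)
      exact_mod_cast hle
    · have hre : (2 * Real.pi * I * n * τ : ℂ).re = -(n * (2 * Real.pi * τ.im)) := by
        simp [Complex.mul_re, Complex.mul_im]
        ring
      rw [hre, mul_neg, neg_le_neg_iff]
      gcongr
  have hd' : DifferentiableOn ℂ logEta {τ : ℂ | δ < τ.im} := by
    unfold logEta
    exact DifferentiableOn.sub (by fun_prop) hd
  exact (hd'.differentiableAt (hU.mem_nhds hmem)).differentiableWithinAt

/-- `logEta` is real on the positive imaginary axis. -/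
theorem logEta_im_eq_zero (y : ℝ) : (logEta (I * y)).im = 0 := by
  have h : logEta (I * y) = ((-(Real.pi * y) / 12 - ∑' n : ℕ+,
      ((ArithmeticFunction.sigma 1 n : ℝ) / (n : ℝ)) * Real.exp (-2 * Real.pi * n * y) : ℝ) : ℂ) := by
    rw [logEta]
    push_cast
    congr 1
    · linear_combination (Real.pi * y / 12 : ℂ) * I_mul_I
    · refine tsum_congr fun n ↦ ?_
      congr 2
      linear_combination (2 * Real.pi * n * y : ℂ) * I_mul_I
  rw [h, ofReal_im]

/-! Integrated as it stands, the term `(m, n)` has absolute integral `arctan(|n| s / |m|)`, which is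
not summable; so Poisson summation comes before integration. For fixed `m` the congruence says `n =
k l + ε* m`, and the sum over `l` is an odd theta kernel at `ε* m / k`. Its functional equation
(`hasSum_thetaSum`) gives a series over `m, j ≥ 1` of `sin(2π ε* m j / k)` times positive functions
of `t` and `a`. These integrate explicitly: over `a` as an exact derivative, over `t` by a
`K_{1/2}`-type Bessel integral. The result is `2 sin(2π ε* m j / k) e^{-2π m j / (k s)} / j`, whose
sum over `m, j` converges absolutely. With `q = e^{2π i τ}` and `τ = (-ε* + i/s)/k`, this is `-2 Im
(q^{mj} / j)`, and `∑ q^{mj} / j` is the `σ(n)/n` series. The linear term of `logEta` contributes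
`-π ε* / (6k)`, which the added constant cancels. -/

/-! ### Integration tools. -/

open Filter Topology in
/-- The fundamental theorem of calculus on `(a, ∞)` for a nonnegative derivative, with limits at
both ends. -/
theorem integrableOn_and_integral_Ioi_of_hasDerivAt_of_nonneg {f f' : ℝ → ℝ} {a l m : ℝ}
    (hderiv : ∀ x ∈ Ioi a, HasDerivAt f (f' x) x) (hpos : ∀ x ∈ Ioi a, 0 ≤ f' x)
    (ha : Tendsto f (𝓝[>] a) (𝓝 l)) (htop : Tendsto f atTop (𝓝 m)) :
    IntegrableOn f' (Ioi a) ∧ ∫ x in Ioi a, f' x = m - l := by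
  -- Giving `f` its limit as value at `a` makes it right-continuous there.
  set g := Function.update f a l with hg
  have hga : g a = l := by simp [hg]
  have hgd : ∀ x ∈ Ioi a, HasDerivAt g (f' x) x := fun x hx ↦ by
    refine (hderiv x hx).congr_of_eventuallyEq ?_
    filter_upwards [Ioi_mem_nhds hx] with y hy
    exact Function.update_of_ne (ne_of_gt hy) _ _
  have hgc : ContinuousWithinAt g (Ici a) a := by
    rw [hg, continuousWithinAt_update_same, Ici_sdiff_left]
    exact ha
  have hgt : Tendsto g atTop (𝓝 m) := by
    refine htop.congr' ?_
    filter_upwards [Ioi_mem_atTop a] with y hy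
    exact (Function.update_of_ne (ne_of_gt hy) _ _).symm
  have hint := integrableOn_Ioi_deriv_of_nonneg hgc hgd hpos hgt
  exact ⟨hint, by rw [integral_Ioi_of_hasDerivAt_of_tendsto hgc hgd hint hgt, hga]⟩

/-- A countable series `∑ cᵢ gᵢ` with bounded coefficients and nonnegative functions of summable
integrals is integrable and may be integrated term by term. -/
theorem integrable_and_hasSum_integral_of_nonneg {α ι : Type*} [MeasurableSpace α] {μ : Measure α}
    [Countable ι] {g : ι → α → ℝ} {c : ι → ℝ} {F : α → ℝ} (hc : ∀ i, |c i| ≤ 1)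
    (hg : ∀ i, Integrable (g i) μ) (hpos : ∀ i, 0 ≤ᵐ[μ] g i)
    (hsum : Summable fun i ↦ ∫ x, g i x ∂μ)
    (hF : ∀ᵐ x ∂μ, HasSum (fun i ↦ c i * g i x) (F x)) :
    Integrable F μ ∧ HasSum (fun i ↦ c i * ∫ x, g i x ∂μ) (∫ x, F x ∂μ) := by
  have hFi : ∀ i, Integrable (fun x ↦ c i * g i x) μ := fun i ↦ (hg i).const_mul _
  have hn : ∀ i, ∫ x, ‖c i * g i x‖ ∂μ = |c i| * ∫ x, g i x ∂μ := by
    intro i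
    rw [← integral_const_mul]
    refine integral_congr_ae ?_
    filter_upwards [hpos i] with x hx
    rw [norm_mul, Real.norm_eq_abs, Real.norm_of_nonneg hx]
  have h0 : ∀ i, 0 ≤ ∫ x, g i x ∂μ := fun i ↦ integral_nonneg_of_ae (hpos i)
  have hsn : Summable fun i ↦ ∫ x, ‖c i * g i x‖ ∂μ := by
    refine Summable.of_nonneg_of_le (fun i ↦ ?_) (fun i ↦ ?_) hsum
    · rw [hn]; exact mul_nonneg (abs_nonneg _) (h0 i)
    · rw [hn]; exact mul_le_of_le_one_left (h0 i) (hc i)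
  have hFt : F =ᵐ[μ] fun x ↦ ∑' i, c i * g i x := by
    filter_upwards [hF] with x hx using hx.tsum_eq.symm
  refine ⟨?_, ?_⟩
  · have hfin : ∑' i, ∫⁻ x, ‖c i * g i x‖ₑ ∂μ ≠ ⊤ := by
      have : ∀ i, ∫⁻ x, ‖c i * g i x‖ₑ ∂μ = ENNReal.ofReal (∫ x, ‖c i * g i x‖ ∂μ) := fun i ↦
        (ofReal_integral_norm_eq_lintegral_enorm (hFi i)).symm
      simp_rw [this]
      exact hsn.tsum_ofReal_ne_top
    refine Integrable.congr ?_ hFt.symm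
    refine ⟨?_, ?_⟩
    · refine (aestronglyMeasurable_of_tendsto_ae (Filter.atTop : Filter (Finset ι))
        (f := fun s x ↦ ∑ i ∈ s, c i * g i x) (fun s ↦ ?_) hF).congr hFt
      exact Finset.aestronglyMeasurable_fun_sum s fun i _ ↦ (hFi i).aestronglyMeasurable
    · refine lt_of_le_of_lt (lintegral_mono fun x ↦ enorm_tsum_le_tsum_enorm) ?_
      rw [lintegral_tsum fun i ↦ (hFi i).aestronglyMeasurable.enorm]
      exact hfin.lt_top
  · have h := hasSum_integral_of_summable_integral_norm hFi hsn
    rw [integral_congr_ae hFt]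
    simpa only [integral_const_mul] using h

/-! ### The two explicit integrals. -/

open Filter Topology in
/-- `∫_0^s a⁻³ e^{-B/a²} da = e^{-B/s²} / (2B)`. -/
theorem intervalIntegral_inv_cube_mul_exp_neg_div_sq {B : ℝ} (hB : 0 < B) {s : ℝ} (hs : 0 < s) :
    IntervalIntegrable (fun a : ℝ ↦ (a ^ 3)⁻¹ * Real.exp (-(B / a ^ 2))) volume 0 s ∧
    ∫ a in (0 : ℝ)..s, (a ^ 3)⁻¹ * Real.exp (-(B / a ^ 2)) =
      Real.exp (-(B / s ^ 2)) / (2 * B) := by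
  set f : ℝ → ℝ := fun a ↦ Real.exp (-(B / a ^ 2)) / (2 * B) with hf
  have hd : ∀ a ∈ Ioi (0 : ℝ), HasDerivAt f ((a ^ 3)⁻¹ * Real.exp (-(B / a ^ 2))) a := by
    intro a ha
    have ha' : a ≠ 0 := ne_of_gt ha
    have h := ((((hasDerivAt_pow 2 a).fun_inv (pow_ne_zero 2 ha')).const_mul B).neg.exp).div_const
      (2 * B)
    refine (h.congr_of_eventuallyEq (Eventually.of_forall fun x ↦ ?_)).congr_deriv ?_
    · simp [hf, div_eq_mul_inv]
    · simp only [Pi.neg_apply]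
      rw [← div_eq_mul_inv]
      push_cast
      field_simp
  have h0 : Tendsto f (𝓝[>] 0) (𝓝 0) := by
    have h1 : Tendsto (fun a : ℝ ↦ a ^ 2) (𝓝[>] 0) (𝓝[>] 0) := by
      refine tendsto_nhdsWithin_iff.mpr ⟨?_, ?_⟩
      · have : Tendsto (fun a : ℝ ↦ a ^ 2) (𝓝 0) (𝓝 (0 ^ 2)) := (continuous_pow 2).tendsto 0
        simpa using this.mono_left nhdsWithin_le_nhds
      · filter_upwards [self_mem_nhdsWithin] with a ha
        exact pow_pos (mem_Ioi.mp ha) 2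
    have h2 : Tendsto (fun a : ℝ ↦ B / a ^ 2) (𝓝[>] 0) atTop := by
      simp only [div_eq_mul_inv]
      exact (tendsto_inv_nhdsGT_zero.comp h1).const_mul_atTop hB
    have h3 := (Real.tendsto_exp_neg_atTop_nhds_zero.comp h2).div_const (2 * B)
    simpa using! h3
  have htop : Tendsto f atTop (𝓝 (1 / (2 * B))) := by
    have h2 : Tendsto (fun a : ℝ ↦ B / a ^ 2) atTop (𝓝 0) :=
      (tendsto_pow_atTop two_ne_zero).const_div_atTop B
    have h3 := ((Real.continuous_exp.tendsto _).comp h2.neg).div_const (2 * B)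
    simpa using! h3
  have hint := (integrableOn_and_integral_Ioi_of_hasDerivAt_of_nonneg hd
    (fun a ha ↦ by have : (0 : ℝ) < a := ha; positivity) h0 htop).1
  have hi : IntervalIntegrable (fun a : ℝ ↦ (a ^ 3)⁻¹ * Real.exp (-(B / a ^ 2))) volume 0 s := by
    rw [intervalIntegrable_iff_integrableOn_Ioc_of_le hs.le]
    exact hint.mono_set Ioc_subset_Ioi_self
  refine ⟨hi, ?_⟩
  rw [intervalIntegral.integral_eq_sub_of_hasDerivAt_of_tendsto hs (fun x hx ↦ hd x hx.1) hi h0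
    ((hd s hs).continuousAt.tendsto.mono_left nhdsWithin_le_nhds), sub_zero]

/-- The unnormalised error function `x ↦ ∫_0^x e^{-v²} dv`. -/
noncomputable def gaussPrimitive (x : ℝ) : ℝ := ∫ v in (0 : ℝ)..x, Real.exp (-1 * v ^ 2)

theorem hasDerivAt_gaussPrimitive (x : ℝ) :
    HasDerivAt gaussPrimitive (Real.exp (-x ^ 2)) x := by
  have hc : Continuous fun v : ℝ ↦ Real.exp (-1 * v ^ 2) := by fun_prop
  have h := (hc.integral_hasStrictDerivAt 0 x).hasDerivAt
  rwa [neg_one_mul] at h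

theorem gaussPrimitive_neg (x : ℝ) : gaussPrimitive (-x) = -gaussPrimitive x := by
  have h := intervalIntegral.integral_comp_neg (a := 0) (b := x)
    (fun v : ℝ ↦ Real.exp (-1 * v ^ 2))
  simp only [neg_zero, even_two, Even.neg_pow] at h
  rw [gaussPrimitive, gaussPrimitive, intervalIntegral.integral_symm, h]

open Filter Topology in
theorem tendsto_gaussPrimitive_atTop :
    Tendsto gaussPrimitive atTop (𝓝 (√Real.pi / 2)) := by
  have h := intervalIntegral_tendsto_integral_Ioi 0
    (integrable_exp_neg_mul_sq one_pos).integrableOn tendsto_id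
  rw [integral_gaussian_Ioi, div_one] at h
  exact h

open Filter Topology in
theorem tendsto_gaussPrimitive_atBot :
    Tendsto gaussPrimitive atBot (𝓝 (-(√Real.pi / 2))) := by
  refine (tendsto_gaussPrimitive_atTop.comp tendsto_neg_atBot_atTop).neg.congr fun x ↦ ?_
  simp [gaussPrimitive_neg]

open Filter Topology in
/-- `∫_0^∞ t^{-1/2} e^{-m² t - b²/t} dt = (√π / m) e^{-2mb}`. -/
theorem integral_Ioi_inv_sqrt_mul_exp {m b : ℝ} (hm : 0 < m) (hb : 0 < b) :
    IntegrableOn (fun t : ℝ ↦ (√t)⁻¹ * Real.exp (-(m ^ 2 * t + b ^ 2 / t))) (Ioi 0) ∧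
    ∫ t in Ioi (0 : ℝ), (√t)⁻¹ * Real.exp (-(m ^ 2 * t + b ^ 2 / t)) =
      √Real.pi / m * Real.exp (-(2 * m * b)) := by
  -- Since `(m√t ∓ b/√t)² = m² t + b²/t ∓ 2mb`, both summands differentiate to multiples of the
  -- integrand, and their `b t^{-3/2}` parts cancel.
  set f : ℝ → ℝ := fun t ↦
    (gaussPrimitive (m * √t - b * (√t)⁻¹) * Real.exp (-(2 * m * b)) +
      gaussPrimitive (m * √t + b * (√t)⁻¹) * Real.exp (2 * m * b)) / m with hf
  have hd : ∀ t ∈ Ioi (0 : ℝ),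
      HasDerivAt f ((√t)⁻¹ * Real.exp (-(m ^ 2 * t + b ^ 2 / t))) t := by
    intro t ht
    have ht0 : (0 : ℝ) < t := ht
    have hs0 : 0 < √t := Real.sqrt_pos.mpr ht0
    have hss : t = √t ^ 2 := (Real.sq_sqrt ht0.le).symm
    have h1 := Real.hasDerivAt_sqrt ht0.ne'
    have h2 := h1.fun_inv hs0.ne'
    have hA := (hasDerivAt_gaussPrimitive (m * √t - b * (√t)⁻¹)).comp t
      ((h1.const_mul m).sub (h2.const_mul b))
    have hB := (hasDerivAt_gaussPrimitive (m * √t + b * (√t)⁻¹)).comp t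
      ((h1.const_mul m).add (h2.const_mul b))
    have h := ((hA.mul_const (Real.exp (-(2 * m * b)))).add
      (hB.mul_const (Real.exp (2 * m * b)))).div_const m
    refine h.congr_deriv ?_
    have e1 : Real.exp (-(m ^ 2 * t + b ^ 2 / t)) =
        Real.exp (-(m * √t - b * (√t)⁻¹) ^ 2) * Real.exp (-(2 * m * b)) := by
      rw [← Real.exp_add]
      congr 1
      rw [hss, Real.sqrt_sq hs0.le]
      field_simp
      ring
    have e2 : Real.exp (-(m ^ 2 * t + b ^ 2 / t)) =
        Real.exp (-(m * √t + b * (√t)⁻¹) ^ 2) * Real.exp (2 * m * b) := by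
      rw [← Real.exp_add]
      congr 1
      rw [hss, Real.sqrt_sq hs0.le]
      field_simp
      ring
    rw [mul_right_comm, ← e1, mul_right_comm, ← e2]
    field_simp
    ring
  have hs0 : Tendsto (fun t : ℝ ↦ √t) (𝓝[>] 0) (𝓝[>] 0) := by
    refine tendsto_nhdsWithin_iff.mpr ⟨?_, ?_⟩
    · have := (Real.continuous_sqrt.tendsto 0).mono_left (nhdsWithin_le_nhds (s := Ioi 0))
      simpa using this
    · filter_upwards [self_mem_nhdsWithin] with a ha using Real.sqrt_pos.mpr ha
  have hs0' : Tendsto (fun t : ℝ ↦ m * √t) (𝓝[>] 0) (𝓝 0) := by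
    simpa using (hs0.mono_right nhdsWithin_le_nhds).const_mul m
  have hi0 : Tendsto (fun t : ℝ ↦ b * (√t)⁻¹) (𝓝[>] 0) atTop :=
    (tendsto_inv_nhdsGT_zero.comp hs0).const_mul_atTop hb
  have hst : Tendsto (fun t : ℝ ↦ m * √t) atTop atTop :=
    Real.tendsto_sqrt_atTop.const_mul_atTop hm
  have hit : Tendsto (fun t : ℝ ↦ b * (√t)⁻¹) atTop (𝓝 0) := by
    simpa using (tendsto_inv_atTop_zero.comp Real.tendsto_sqrt_atTop).const_mul b
  -- Only the argument `m√t - b/√t` has different limits at the two ends, `-∞` and `+∞`; hence the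
  -- `e^{2mb}` terms drop out of the difference.
  have h0 : Tendsto f (𝓝[>] 0) (𝓝 ((-(√Real.pi / 2) * Real.exp (-(2 * m * b)) +
      √Real.pi / 2 * Real.exp (2 * m * b)) / m)) := by
    refine Tendsto.div_const (Tendsto.add (Tendsto.mul_const _ ?_) (Tendsto.mul_const _ ?_)) _
    · refine tendsto_gaussPrimitive_atBot.comp ?_
      simp only [sub_eq_add_neg]
      exact hs0'.add_atBot (tendsto_neg_atTop_atBot.comp hi0)
    · exact tendsto_gaussPrimitive_atTop.comp (hs0'.add_atTop hi0)
  have htop : Tendsto f atTop (𝓝 ((√Real.pi / 2 * Real.exp (-(2 * m * b)) +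
      √Real.pi / 2 * Real.exp (2 * m * b)) / m)) := by
    refine Tendsto.div_const (Tendsto.add (Tendsto.mul_const _ ?_) (Tendsto.mul_const _ ?_)) _
    · refine tendsto_gaussPrimitive_atTop.comp ?_
      simpa only [sub_eq_add_neg] using hst.atTop_add hit.neg
    · exact tendsto_gaussPrimitive_atTop.comp (hst.atTop_add hit)
  obtain ⟨hint, hval⟩ := integrableOn_and_integral_Ioi_of_hasDerivAt_of_nonneg hd
    (fun t ht ↦ by have : (0 : ℝ) < t := ht; positivity) h0 htop
  refine ⟨hint, hval.trans ?_⟩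
  ring

/-! ### The theta series and Poisson summation. -/

theorem summable_int_mul_exp_neg_mul_sq {t : ℝ} (ht : 0 < t) :
    Summable fun m : ℤ ↦ (m : ℝ) * Real.exp (-t * (m : ℝ) ^ 2) := by
  have h := (HurwitzZeta.hasSum_int_oddKernel 0 (div_pos ht Real.pi_pos)).summable
  refine h.congr fun m ↦ ?_
  rw [add_zero]
  congr 2
  field_simp

theorem summable_pnat_mul_exp_neg_mul_sq {t : ℝ} (ht : 0 < t) :
    Summable fun m : ℕ+ ↦ (m : ℝ) * Real.exp (-t * (m : ℝ) ^ 2) := by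
  have h := (summable_int_mul_exp_neg_mul_sq ht).comp_injective
    (i := fun m : ℕ+ ↦ ((m : ℕ) : ℤ)) fun a b hab ↦ PNat.coe_injective (Int.ofNat_injective hab)
  simpa [Function.comp_def] using h

theorem summable_int_prod_thetaSum {t a : ℝ} (ht : 0 < t) (ha : 0 < a) :
    Summable fun p : ℤ × ℤ ↦ (p.1 : ℝ) * (p.2 : ℝ) *
      Real.exp (-t * ((p.1 : ℝ) ^ 2 + (p.2 : ℝ) ^ 2 * a ^ 2)) := by
  have h := summable_mul_of_summable_norm (summable_int_mul_exp_neg_mul_sq ht).norm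
    (summable_int_mul_exp_neg_mul_sq (show 0 < t * a ^ 2 by positivity)).norm
  refine h.congr fun p ↦ ?_
  rw [mul_mul_mul_comm, ← Real.exp_add]
  congr 2
  ring

/-- The solutions of `m ≡ ε n (mod k)` are parametrised by `(m, l) ↦ (m, k l + ε* m)`. -/
def congruencePairsEquiv {k : ℕ} (hk : 0 < k) {ε εstar : ℤ} (h : ε * εstar ≡ 1 [ZMOD (k : ℤ)]) :
    ℤ × ℤ ≃ {p : ℤ × ℤ // p.1 ≡ ε * p.2 [ZMOD (k : ℤ)]} where
  toFun q := ⟨(q.1, k * q.2 + εstar * q.1), by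
    have h1 := (Int.modEq_iff_dvd.mp h)
    refine (Int.modEq_iff_dvd.mpr ?_)
    obtain ⟨c, hc⟩ := h1
    exact ⟨ε * q.2 - c * q.1, by simp only; linear_combination (-q.1) * hc⟩⟩
  invFun p := (p.1.1, (p.1.2 - εstar * p.1.1) / k)
  left_inv q := by
    have : (k : ℤ) ≠ 0 := by exact_mod_cast hk.ne'
    simp [Int.mul_ediv_cancel_left _ this]
  right_inv p := by
    obtain ⟨⟨m, n⟩, hp⟩ := p
    have hd : (k : ℤ) ∣ n - εstar * m := by
      obtain ⟨c, hc⟩ := Int.modEq_iff_dvd.mp h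
      obtain ⟨d, hd⟩ := Int.modEq_iff_dvd.mp hp
      simp only at hd
      exact ⟨c * n + εstar * d, by linear_combination n * hc + εstar * hd⟩
    ext
    · rfl
    · simp [Int.mul_ediv_cancel' hd]

-- For fixed `m`, `n / k` runs over the coset `ε* m / k + ℤ`, so the inner sum is an odd kernel; the
-- factor `k` comes from `n = k (n / k)`.
open HurwitzZeta in
theorem thetaSum_eq_tsum_oddKernel {k : ℕ} (hk : 0 < k) {ε εstar : ℤ}
    (h : ε * εstar ≡ 1 [ZMOD (k : ℤ)]) {t a : ℝ} (ht : 0 < t) (ha : 0 < a) :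
    Summable (fun m : ℤ ↦ (m : ℝ) * Real.exp (-t * (m : ℝ) ^ 2) *
      (k * oddKernel ((εstar * m / k : ℝ) : UnitAddCircle) (t * a ^ 2 * k ^ 2 / Real.pi))) ∧
    thetaSum k ε t a = ∑' m : ℤ, (m : ℝ) * Real.exp (-t * (m : ℝ) ^ 2) *
      (k * oddKernel ((εstar * m / k : ℝ) : UnitAddCircle) (t * a ^ 2 * k ^ 2 / Real.pi)) := by
  have hk' : (0 : ℝ) < k := by exact_mod_cast hk
  have hx : 0 < t * a ^ 2 * k ^ 2 / Real.pi := by positivity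
  set e := congruencePairsEquiv hk h
  have hs : Summable fun q : ℤ × ℤ ↦ ((e q).1.1 : ℝ) * ((e q).1.2 : ℝ) *
      Real.exp (-t * (((e q).1.1 : ℝ) ^ 2 + ((e q).1.2 : ℝ) ^ 2 * a ^ 2)) :=
    e.summable_iff.mpr ((summable_int_prod_thetaSum ht ha).subtype _)
  have hin : ∀ m : ℤ, HasSum (fun l : ℤ ↦ ((e (m, l)).1.1 : ℝ) * ((e (m, l)).1.2 : ℝ) *
      Real.exp (-t * (((e (m, l)).1.1 : ℝ) ^ 2 + ((e (m, l)).1.2 : ℝ) ^ 2 * a ^ 2)))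
      ((m : ℝ) * Real.exp (-t * (m : ℝ) ^ 2) *
      (k * oddKernel ((εstar * m / k : ℝ) : UnitAddCircle) (t * a ^ 2 * k ^ 2 / Real.pi))) := by
    intro m
    refine (((hasSum_int_oddKernel (εstar * m / k : ℝ) hx).mul_left (k : ℝ)).mul_left
      ((m : ℝ) * Real.exp (-t * (m : ℝ) ^ 2))).congr_fun fun l ↦ ?_
    have e1 : (e (m, l)).1.1 = m := rfl
    have e2 : (e (m, l)).1.2 = k * l + εstar * m := rfl
    rw [e1, e2, mul_add (-t), Real.exp_add]
    push_cast
    have e3 : -Real.pi * ((l : ℝ) + εstar * m / k) ^ 2 * (t * a ^ 2 * k ^ 2 / Real.pi) =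
        -t * ((k * l + εstar * m) ^ 2 * a ^ 2) := by
      field_simp
    rw [e3]
    field_simp
  refine ⟨?_, ?_⟩
  · exact hs.prod.congr fun m ↦ (hin m).tsum_eq
  · rw [thetaSum, ← e.tsum_eq, hs.tsum_prod]
    exact tsum_congr fun m ↦ (hin m).tsum_eq

/-- The dual expansion of the theta series obtained by Poisson summation over `n`. -/
theorem hasSum_thetaSum {k : ℕ} (hk : 0 < k) {ε εstar : ℤ}
    (h : ε * εstar ≡ 1 [ZMOD (k : ℤ)]) {t a : ℝ} (ht : 0 < t) (ha : 0 < a) :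
    HasSum (fun p : ℕ+ × ℕ+ ↦ Real.sin (2 * Real.pi * εstar * (p.1 * p.2 : ℕ) / k) *
      (4 * √Real.pi ^ 3 / (√t ^ 3 * k ^ 2) * (p.1 * Real.exp (-t * (p.1 : ℝ) ^ 2)) * p.2 *
        ((a ^ 3)⁻¹ * Real.exp (-(Real.pi ^ 2 * (p.2 : ℝ) ^ 2 / (t * k ^ 2) / a ^ 2)))))
      (thetaSum k ε t a) := by
  have hk' : (0 : ℝ) < k := by exact_mod_cast hk
  have hpi := Real.pi_pos
  obtain ⟨hs, heq⟩ := thetaSum_eq_tsum_oddKernel hk h ht ha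
  set x := t * a ^ 2 * k ^ 2 / Real.pi with hxdef
  have hx : 0 < x := by positivity
  have hx32 : x ^ (3 / 2 : ℝ) = (√t * a * k / √Real.pi) ^ 3 := by
    have : √x = √t * a * k / √Real.pi := by
      rw [hxdef, Real.sqrt_div (by positivity), Real.sqrt_mul (by positivity),
        Real.sqrt_mul ht.le, Real.sqrt_sq ha.le, Real.sqrt_sq hk'.le]
    rw [← this, Real.sqrt_eq_rpow, ← Real.rpow_natCast, ← Real.rpow_mul hx.le]
    norm_num
  -- Both `m` and the kernel change sign under `m ↦ -m`, so the sum folds onto `m ≥ 1`.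
  have heven : Function.Even fun m : ℤ ↦ (m : ℝ) * Real.exp (-t * (m : ℝ) ^ 2) *
      (k * HurwitzZeta.oddKernel ((εstar * m / k : ℝ) : UnitAddCircle) x) := by
    intro m
    have : ((εstar * (-m : ℤ) / k : ℝ) : UnitAddCircle) =
        -((εstar * m / k : ℝ) : UnitAddCircle) := by
      rw [← QuotientAddGroup.mk_neg]
      congr 1
      push_cast
      ring
    simp only [this, HurwitzZeta.oddKernel_neg]
    push_cast
    rw [neg_sq]
    ring
  rw [tsum_int_eq_zero_add_two_mul_tsum_pnat heven hs] at heq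
  set F : ℕ+ × ℕ+ → ℝ := fun p ↦ Real.sin (2 * Real.pi * εstar * (p.1 * p.2 : ℕ) / k) *
      (4 * √Real.pi ^ 3 / (√t ^ 3 * k ^ 2) * (p.1 * Real.exp (-t * (p.1 : ℝ) ^ 2)) * p.2 *
        ((a ^ 3)⁻¹ * Real.exp (-(Real.pi ^ 2 * (p.2 : ℝ) ^ 2 / (t * k ^ 2) / a ^ 2)))) with hF
  have hFs : Summable F := by
    have h1 := (summable_mul_of_summable_norm (summable_pnat_mul_exp_neg_mul_sq ht).norm
      (summable_pnat_mul_exp_neg_mul_sq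
        (show 0 < Real.pi ^ 2 / (t * k ^ 2 * a ^ 2) by positivity)).norm).mul_left
      (4 * √Real.pi ^ 3 / (√t ^ 3 * k ^ 2) * (a ^ 3)⁻¹)
    refine Summable.of_norm_bounded h1 fun p ↦ ?_
    rw [hF]
    simp only
    rw [norm_mul]
    refine (mul_le_of_le_one_left (norm_nonneg _) (Real.abs_sin_le_one _)).trans_eq ?_
    rw [Real.norm_of_nonneg (by positivity)]
    have : -(Real.pi ^ 2 * (p.2 : ℝ) ^ 2 / (t * k ^ 2) / a ^ 2) =
        -(Real.pi ^ 2 / (t * k ^ 2 * a ^ 2)) * (p.2 : ℝ) ^ 2 := by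
      field_simp
    rw [this]
    ring
  -- The constant 4 in `F` is this 2, from folding `±m`, times the 2 in the sine series of the dual
  -- kernel.
  have hrow : ∀ m : ℕ+, 2 * ((((m : ℕ) : ℤ) : ℝ) * Real.exp (-t * (((m : ℕ) : ℤ) : ℝ) ^ 2) *
      (k * HurwitzZeta.oddKernel ((εstar * ((m : ℕ) : ℤ) / k : ℝ) : UnitAddCircle) x)) =
      ∑' j : ℕ+, F (m, j) := by
    intro m
    have hsin := HurwitzZeta.hasSum_nat_sinKernel (εstar * ((m : ℕ) : ℤ) / k : ℝ)
      (one_div_pos.mpr hx)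
    have hval := hsin.tsum_eq
    rw [← tsum_zero_pnat_eq_tsum_nat hsin.summable] at hval
    rw [HurwitzZeta.oddKernel_functional_equation, ← hval, hx32]
    simp only [CharP.cast_eq_zero, mul_zero, zero_mul, zero_add]
    simp only [← tsum_mul_left]
    refine tsum_congr fun j ↦ ?_
    have e1 : 2 * Real.pi * (εstar * ((m : ℕ) : ℤ) / k : ℝ) * (j : ℕ) =
        2 * Real.pi * εstar * (m * j : ℕ) / k := by
      push_cast
      ring
    have e2 : -Real.pi * ((j : ℕ) : ℝ) ^ 2 * (1 / x) =
        -(Real.pi ^ 2 * ((j : ℕ) : ℝ) ^ 2 / (t * k ^ 2) / a ^ 2) := by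
      rw [hxdef]
      field_simp
    rw [e1, e2, hF]
    have : 0 < √t := Real.sqrt_pos.mpr ht
    have : 0 < √Real.pi := Real.sqrt_pos.mpr hpi
    simp only [Int.cast_natCast]
    field_simp
    ring
  have : thetaSum k ε t a = ∑' p, F p := by
    rw [heq, hFs.tsum_prod, two_nsmul, ← two_mul, ← tsum_mul_left]
    simp only [Int.cast_zero, zero_mul, zero_add]
    exact tsum_congr hrow
  rw [this]
  exact hFs.hasSum

/-! ### The double series for `logEta`. -/

theorem summable_pow_mul_div {q : ℂ} (hq : ‖q‖ < 1) :
    Summable fun c : ℕ+ × ℕ+ ↦ q ^ (c.1 * c.2 : ℕ) / (c.2 : ℂ) := by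
  have hs0 : Summable fun c : ℕ+ × ℕ+ ↦ q ^ (c.1 * c.2 : ℕ) := by
    simpa using summable_prod_mul_pow 0 hq
  refine Summable.of_norm_bounded hs0.norm fun c ↦ ?_
  rw [norm_div]
  refine div_le_self (norm_nonneg _) ?_
  rw [Complex.norm_natCast]
  exact_mod_cast c.2.pos

/-- The `σ(n)/n` series of `logEta` as a double series. -/
theorem logEta_eq_sub_tsum_prod {τ : ℂ} (hτ : 0 < τ.im) :
    logEta τ = Real.pi * I * τ / 12 -
      ∑' c : ℕ+ × ℕ+, exp (2 * Real.pi * I * τ) ^ (c.1 * c.2 : ℕ) / (c.2 : ℂ) := by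
  set q := exp (2 * Real.pi * I * τ) with hq
  have hs := summable_pow_mul_div (norm_exp_two_pi_mul_lt_one hτ)
  rw [← hq] at hs
  rw [logEta]
  congr 1
  rw [← sigmaAntidiagonalEquivProd.tsum_eq]
  have hs' := sigmaAntidiagonalEquivProd.summable_iff.mpr hs
  rw [Summable.tsum_sigma (by simpa [Function.comp_def] using! hs')]
  refine tsum_congr fun n ↦ ?_
  have hexp : exp (2 * Real.pi * I * n * τ) = q ^ (n : ℕ) := by
    rw [hq, ← Complex.exp_nat_mul]; congr 1; ring
  rw [hexp, tsum_fintype]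
  -- For `u v = n` one has `1 / v = u / n`, so the terms with product `n` add up to `σ(n)/n`.
  have h1 : ∀ x : (n : ℕ).divisorsAntidiagonal,
      q ^ (((sigmaAntidiagonalEquivProd ⟨n, x⟩).1 : ℕ) *
        ((sigmaAntidiagonalEquivProd ⟨n, x⟩).2 : ℕ)) /
        ((sigmaAntidiagonalEquivProd ⟨n, x⟩).2 : ℂ) =
      (fun y : ℕ × ℕ ↦ (y.1 : ℂ) / n * q ^ (n : ℕ)) x.1 := by
    rintro ⟨⟨u, v⟩, hx⟩
    have hx' := (Nat.mem_divisorsAntidiagonal.mp hx).1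
    have hn : (n : ℂ) ≠ 0 := by exact_mod_cast n.ne_zero
    have huv : (u : ℂ) * v = n := by exact_mod_cast hx'
    have hv : (v : ℂ) ≠ 0 := by rintro h; simp [h] at huv; exact hn huv.symm
    simp only [sigmaAntidiagonalEquivProd, divisorsAntidiagonalFactors, Equiv.coe_fn_mk,
      PNat.mk_coe] at hx' ⊢
    rw [hx', div_mul_eq_mul_div, div_eq_div_iff hv hn, ← huv]
    ring
  rw [Finset.sum_congr rfl fun x _ ↦ h1 x, Finset.univ_eq_attach,
    Finset.sum_attach (n : ℕ).divisorsAntidiagonal (fun y : ℕ × ℕ ↦ (y.1 : ℂ) / n * q ^ (n : ℕ)),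
    Nat.sum_divisorsAntidiagonal (fun x _ ↦ (x : ℂ) / n * q ^ (n : ℕ)),
    ← Finset.sum_mul, ← Finset.sum_div, ArithmeticFunction.sigma_one_apply]
  push_cast
  rfl

/-! ### Termwise integration. -/

/-- Term by term integration over `a` of the dual expansion of the theta series. -/
theorem intervalIntegrable_and_hasSum_integral_thetaSum {k : ℕ} (hk : 0 < k) {ε εstar : ℤ}
    (h : ε * εstar ≡ 1 [ZMOD (k : ℤ)]) {s t : ℝ} (hs : 0 < s) (ht : 0 < t) :
    IntervalIntegrable (fun a : ℝ ↦ thetaSum k ε t a) volume 0 s ∧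
    HasSum (fun p : ℕ+ × ℕ+ ↦ Real.sin (2 * Real.pi * εstar * (p.1 * p.2 : ℕ) / k) *
      (2 / √Real.pi * (p.1 / p.2) * ((√t)⁻¹ *
        Real.exp (-((p.1 : ℝ) ^ 2 * t + (Real.pi * p.2 / (k * s)) ^ 2 / t)))))
      (∫ a in (0 : ℝ)..s, thetaSum k ε t a) := by
  have hk' : (0 : ℝ) < k := by exact_mod_cast hk
  have hpi := Real.pi_pos
  have hst : 0 < √t := Real.sqrt_pos.mpr ht
  have hspi : 0 < √Real.pi := Real.sqrt_pos.mpr hpi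
  set g : ℕ+ × ℕ+ → ℝ → ℝ := fun p a ↦
    4 * √Real.pi ^ 3 / (√t ^ 3 * k ^ 2) * (p.1 * Real.exp (-t * (p.1 : ℝ) ^ 2)) * p.2 *
      ((a ^ 3)⁻¹ * Real.exp (-(Real.pi ^ 2 * (p.2 : ℝ) ^ 2 / (t * k ^ 2) / a ^ 2))) with hg
  have hB : ∀ p : ℕ+ × ℕ+, 0 < Real.pi ^ 2 * (p.2 : ℝ) ^ 2 / (t * k ^ 2) := fun p ↦ by
    have : (0 : ℝ) < p.2 := by exact_mod_cast p.2.pos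
    positivity
  have hval : ∀ p : ℕ+ × ℕ+, ∫ a in Ioc 0 s, g p a = 2 / √Real.pi * (p.1 / p.2) * ((√t)⁻¹ *
        Real.exp (-((p.1 : ℝ) ^ 2 * t + (Real.pi * p.2 / (k * s)) ^ 2 / t))) := by
    intro p
    have hp2 : (0 : ℝ) < p.2 := by exact_mod_cast p.2.pos
    rw [hg]
    simp only
    rw [integral_const_mul, ← intervalIntegral.integral_of_le hs.le,
      (intervalIntegral_inv_cube_mul_exp_neg_div_sq (hB p) hs).2, neg_add, Real.exp_add]
    have e1 : -(Real.pi ^ 2 * (p.2 : ℝ) ^ 2 / (t * k ^ 2) / s ^ 2) =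
        -((Real.pi * p.2 / (k * s)) ^ 2 / t) := by
      field_simp
    have e2 : -t * (p.1 : ℝ) ^ 2 = -((p.1 : ℝ) ^ 2 * t) := by ring
    rw [e1, e2]
    have e3 : √Real.pi ^ 4 = Real.pi ^ 2 := by
      rw [show (4 : ℕ) = 2 * 2 from rfl, pow_mul, Real.sq_sqrt hpi.le]
    have e4 : √t ^ 2 = t := Real.sq_sqrt ht.le
    rw [← e3]
    field_simp
    rw [e4]
    ring
  have hsum : Summable fun p : ℕ+ × ℕ+ ↦ ∫ a in Ioc 0 s, g p a := by
    have h1 := (summable_mul_of_summable_norm (summable_pnat_mul_exp_neg_mul_sq ht).norm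
      (summable_pnat_mul_exp_neg_mul_sq
        (show 0 < (Real.pi / (k * s)) ^ 2 / t by positivity)).norm).mul_left
      (2 / √Real.pi * (√t)⁻¹)
    refine h1.of_nonneg_of_le (fun p ↦ ?_) fun p ↦ ?_
    · rw [hval]
      positivity
    · have hp2 : (1 : ℝ) ≤ p.2 := by exact_mod_cast p.2.pos
      rw [hval, neg_add, Real.exp_add]
      have e1 : -((Real.pi / (k * s)) ^ 2 / t) * (p.2 : ℝ) ^ 2 =
        -((Real.pi * p.2 / (k * s)) ^ 2 / t) := by ring
      have e2 : -t * (p.1 : ℝ) ^ 2 = -((p.1 : ℝ) ^ 2 * t) := by ring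
      rw [e1, e2]
      -- This crude bound makes the majorant a product of two convergent theta series.
      have e3 : (p.1 : ℝ) / p.2 ≤ p.1 * p.2 := by
        rw [div_eq_mul_inv]
        gcongr
        exact (inv_le_one_of_one_le₀ hp2).trans hp2
      calc _ = (2 / √Real.pi * (√t)⁻¹) * (p.1 / p.2) * (Real.exp (-((p.1 : ℝ) ^ 2 * t)) *
            Real.exp (-((Real.pi * p.2 / (k * s)) ^ 2 / t))) := by ring
        _ ≤ (2 / √Real.pi * (√t)⁻¹) * (p.1 * p.2) * (Real.exp (-((p.1 : ℝ) ^ 2 * t)) *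
            Real.exp (-((Real.pi * p.2 / (k * s)) ^ 2 / t))) := by gcongr
        _ = _ := by ring
  have hint : ∀ p, Integrable (g p) (volume.restrict (Ioc 0 s)) := fun p ↦ by
    have h1 := (intervalIntegral_inv_cube_mul_exp_neg_div_sq (hB p) hs).1
    rw [intervalIntegrable_iff_integrableOn_Ioc_of_le hs.le] at h1
    exact Integrable.const_mul h1 _
  obtain ⟨hi, hS⟩ := integrable_and_hasSum_integral_of_nonneg
    (c := fun p : ℕ+ × ℕ+ ↦ Real.sin (2 * Real.pi * εstar * (p.1 * p.2 : ℕ) / k))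
    (F := fun a ↦ thetaSum k ε t a) (fun _ ↦ Real.abs_sin_le_one _) hint
    (fun p ↦ (ae_restrict_mem measurableSet_Ioc).mono fun a ha ↦ by
      have : 0 < a := ha.1
      simp only [hg, Pi.zero_apply]
      positivity) hsum
    ((ae_restrict_mem measurableSet_Ioc).mono fun a ha ↦ hasSum_thetaSum hk h ht ha.1)
  simp only [hval] at hS
  rw [intervalIntegrable_iff_integrableOn_Ioc_of_le hs.le, intervalIntegral.integral_of_le hs.le]
  exact ⟨hi, hS⟩

theorem exp_two_pi_mul_pow_im (εstar : ℤ) (k N : ℕ) (s : ℝ) :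
    (exp (2 * Real.pi * I * ((-(εstar : ℂ) + I * ((s⁻¹ : ℝ) : ℂ)) / (k : ℂ))) ^ N).im =
      -(Real.sin (2 * Real.pi * εstar * N / k) * Real.exp (-(2 * Real.pi * N / (k * s)))) := by
  have e : (N : ℂ) * (2 * Real.pi * I * ((-(εstar : ℂ) + I * ((s⁻¹ : ℝ) : ℂ)) / (k : ℂ))) =
      ((-(2 * Real.pi * N / (k * s)) : ℝ) : ℂ) +
        ((-(2 * Real.pi * εstar * N / k) : ℝ) : ℂ) * I := by
    push_cast
    linear_combination (2 * Real.pi * N / k * (s : ℂ)⁻¹) * I_mul_I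
  rw [← Complex.exp_nat_mul, e, Complex.exp_im]
  simp only [add_re, ofReal_re, mul_re, ofReal_im, I_re, I_im, add_im, mul_im, mul_zero, mul_one,
    sub_zero, add_zero, zero_add, Real.sin_neg]
  ring

/-- Term by term integration over `t`. -/
theorem integrableOn_and_hasSum_etaFormIntegral {k : ℕ} (hk : 0 < k) {ε εstar : ℤ}
    (h : ε * εstar ≡ 1 [ZMOD (k : ℤ)]) {s : ℝ} (hs : 0 < s) :
    IntegrableOn (fun t : ℝ ↦ ∫ a in (0 : ℝ)..s, thetaSum k ε t a) (Ioi 0) volume ∧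
    HasSum (fun p : ℕ+ × ℕ+ ↦ Real.sin (2 * Real.pi * εstar * (p.1 * p.2 : ℕ) / k) *
      (2 * (Real.exp (-(2 * Real.pi * (p.1 * p.2 : ℕ) / (k * s))) / p.2)))
      (etaFormIntegral k ε s) := by
  have hk' : (0 : ℝ) < k := by exact_mod_cast hk
  have hpi := Real.pi_pos
  have hspi : 0 < √Real.pi := Real.sqrt_pos.mpr hpi
  have hb : ∀ p : ℕ+ × ℕ+, (0 : ℝ) < p.1 ∧ 0 < Real.pi * (p.2 : ℝ) / (k * s) := fun p ↦ by
    have h1 : (0 : ℝ) < p.1 := by exact_mod_cast p.1.pos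
    have h2 : (0 : ℝ) < p.2 := by exact_mod_cast p.2.pos
    exact ⟨h1, by positivity⟩
  set g : ℕ+ × ℕ+ → ℝ → ℝ := fun p t ↦ 2 / √Real.pi * (p.1 / p.2) * ((√t)⁻¹ *
    Real.exp (-((p.1 : ℝ) ^ 2 * t + (Real.pi * p.2 / (k * s)) ^ 2 / t))) with hg
  have hval : ∀ p : ℕ+ × ℕ+, ∫ t in Ioi 0, g p t =
      2 * (Real.exp (-(2 * Real.pi * (p.1 * p.2 : ℕ) / (k * s))) / p.2) := by
    intro p
    have h1 := (hb p).1
    rw [hg]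
    simp only
    rw [integral_const_mul, (integral_Ioi_inv_sqrt_mul_exp (hb p).1 (hb p).2).2]
    have e : -(2 * (p.1 : ℝ) * (Real.pi * p.2 / (k * s))) =
        -(2 * Real.pi * (p.1 * p.2 : ℕ) / (k * s)) := by
      push_cast
      ring
    rw [e]
    field_simp
  have hsum : Summable fun p : ℕ+ × ℕ+ ↦ ∫ t in Ioi 0, g p t := by
    -- Without the sines, the integrated terms are twice `q^{mj} / j` at the real point `q =
    -- e^{-2π/(ks)}`.
    have hr : ‖((Real.exp (-(2 * Real.pi / (k * s))) : ℝ) : ℂ)‖ < 1 := by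
      rw [Complex.norm_real, Real.norm_of_nonneg (Real.exp_pos _).le, Real.exp_lt_one_iff]
      have : 0 < 2 * Real.pi / (k * s) := by positivity
      linarith
    refine ((summable_pow_mul_div hr).norm.mul_left 2).congr fun p ↦ ?_
    rw [hval, norm_div, Complex.norm_natCast, norm_pow, Complex.norm_real,
      Real.norm_of_nonneg (Real.exp_pos _).le, ← Real.exp_nat_mul]
    congr 3
    ring
  obtain ⟨hi, hS⟩ := integrable_and_hasSum_integral_of_nonneg
    (c := fun p : ℕ+ × ℕ+ ↦ Real.sin (2 * Real.pi * εstar * (p.1 * p.2 : ℕ) / k))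
    (F := fun t ↦ ∫ a in (0 : ℝ)..s, thetaSum k ε t a) (fun _ ↦ Real.abs_sin_le_one _)
    (fun p ↦ Integrable.const_mul (integral_Ioi_inv_sqrt_mul_exp (hb p).1 (hb p).2).1 _)
    (fun p ↦ (ae_restrict_mem measurableSet_Ioi).mono fun t ht ↦ by
      have : (0 : ℝ) < t := ht
      simp only [Pi.zero_apply]
      positivity) hsum
    ((ae_restrict_mem measurableSet_Ioi).mono fun t ht ↦
      (intervalIntegrable_and_hasSum_integral_thetaSum hk h hs ht).2)
  have hS' : HasSum (fun p : ℕ+ × ℕ+ ↦ Real.sin (2 * Real.pi * εstar * (p.1 * p.2 : ℕ) / k) *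
      ∫ t in Ioi 0, g p t) (etaFormIntegral k ε s) := hS
  simp only [hval] at hS'
  exact ⟨hi, hS'⟩

/-! ### Comparison with `logEta`. -/

theorem propositionA1 (k : ℕ) (hk : 0 < k) (ε : ℤ) (hε : IsCoprime ε (k : ℤ)) (s : ℝ) (hs : 0 < s)
    (εstar : ℤ) (hεstar : ε * εstar ≡ 1 [ZMOD (k : ℤ)]) :
    (∀ t : ℝ, 0 < t → ∀ a : ℝ, 0 < a →
      Summable fun p : {p : ℤ × ℤ // p.1 ≡ ε * p.2 [ZMOD (k : ℤ)]} ↦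
        (p.1.1 : ℝ) * (p.1.2 : ℝ) *
          Real.exp (-t * ((p.1.1 : ℝ) ^ 2 + (p.1.2 : ℝ) ^ 2 * a ^ 2))) ∧
    (∀ t : ℝ, 0 < t → IntervalIntegrable (fun a : ℝ ↦ thetaSum k ε t a) volume 0 s) ∧
    IntegrableOn (fun t : ℝ ↦ ∫ a in (0 : ℝ)..s, thetaSum k ε t a) (Ioi 0) volume ∧
    etaFormIntegral k ε s =
      2 * (logEta ((-(εstar : ℂ) + I * ((s⁻¹ : ℝ) : ℂ)) / (k : ℂ))).im +
        Real.pi * (εstar : ℝ) / (6 * (k : ℝ)) := by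
  have hk' : (0 : ℝ) < k := by exact_mod_cast hk
  obtain ⟨hi, hS⟩ := integrableOn_and_hasSum_etaFormIntegral hk hεstar hs
  refine ⟨fun t ht a ha ↦ (summable_int_prod_thetaSum ht ha).subtype _,
    fun t ht ↦ (intervalIntegrable_and_hasSum_integral_thetaSum hk hεstar hs ht).1, hi, ?_⟩
  set τ : ℂ := (-(εstar : ℂ) + I * ((s⁻¹ : ℝ) : ℂ)) / (k : ℂ) with hτdef
  have him : τ.im = s⁻¹ / k := by
    rw [hτdef, Complex.div_natCast_im]
    simp
  have hre : τ.re = -εstar / k := by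
    rw [hτdef, Complex.div_natCast_re]
    simp
  have hτ : 0 < τ.im := by rw [him]; positivity
  have hq := summable_pow_mul_div (norm_exp_two_pi_mul_lt_one hτ)
  have hlin : (Real.pi * I * τ / 12 : ℂ).im = -(Real.pi * εstar / (12 * k)) := by
    have : (Real.pi * I * τ / 12 : ℂ).im = Real.pi * τ.re / 12 := by
      rw [show (Real.pi * I * τ / 12 : ℂ) = ((Real.pi / 12 : ℝ) : ℂ) * (I * τ) by push_cast; ring,
        Complex.im_ofReal_mul, Complex.I_mul_im]
      ring
    rw [this, hre]
    field_simp
  -- The minus sign in `-2` comes from `Re τ = -ε*/k`, which makes each sine negative in `Im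
  -- q^{mj}`.
  have hterm : HasSum (fun p : ℕ+ × ℕ+ ↦
      Real.sin (2 * Real.pi * εstar * (p.1 * p.2 : ℕ) / k) *
      (2 * (Real.exp (-(2 * Real.pi * (p.1 * p.2 : ℕ) / (k * s))) / p.2)))
      (-2 * (∑' c : ℕ+ × ℕ+, exp (2 * Real.pi * I * τ) ^ (c.1 * c.2 : ℕ) / (c.2 : ℂ)).im) := by
    refine ((Complex.hasSum_im hq.hasSum).mul_left (-2)).congr_fun fun p ↦ ?_
    rw [Complex.div_natCast_im, hτdef, exp_two_pi_mul_pow_im]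
    ring
  rw [hS.unique hterm, logEta_eq_sub_tsum_prod hτ, Complex.sub_im, hlin]
  field_simp
  ring
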